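/- Let $B_r=\{x\in\mathbb{R}^3 : |x|<r\}$, $\rho=|x|$, and let $S^2=\partial B_1$ be the unit sphere (the cosmological horizon of de Sitter space) with its standard surface measure $d\sigma$. For $s\in\mathbb{C}$ let $$L_s u=-\sum_{i,j=1}^3(\delta_{ij}-x_ix_j)\,\partial_i\partial_j u+4\sum_{i=1}^3x_i\partial_i u+2u+2s\Big(\sum_{i=1}^3x_i\partial_i u+\tfrac32 u\Big)+s^2u .$$ Let $\epsilon>0$ and $m\in\mathbb{N}_0$, and let $s\in\mathbb{C}$ with $\operatorname{Re}s>\tfrac12-(m+1)$. A distribution $\theta\in\mathcal{D}'(B_{1+\epsilon})$ is called a quasinormal co-mode of Sobolev order $m$ at the frequency $s$ if (i) there exists $C>0$ such that $|\theta(u)|\le C\|u\|_{H^m(B_1)}$ for all $u\in C_c^\infty(B_{1+\epsilon})$, where $\|u\|_{H^m(B_1)}^2=\sum_{|\alpha|\le m}\int_{B_1}|\partial^\alpha u|^2\,dx$; (ii) $\theta(L_su)=0$ for all $u\in C_c^\infty(B_{1+\epsilon})$. Let $\Theta_{00}(f)=\int_{S^2}Y_{00}f\,d\sigma$ with $Y_{00}=1/\sqrt{4\pi}$,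 and let $\tilde Du=\rho^{-1}\big(\sum_{i=1}^3x_i\partial_iu+u\big)=\rho^{-1}\partial_\rho(\rho u)$ for $\rho>0$. For $k\in\mathbb{N}_0$ let $\tilde D^k\Theta_{00}$ be given by $(\tilde D^k\Theta_{00})(f)=(-1)^k\,\Theta_{00}(\tilde D^kf)$ for $f\in C_c^\infty(B_{1+\epsilon})$. Proposition. For every $\epsilon>0$ and every $k\in\mathbb{N}_0$, $\tilde D^k\Theta_{00}$ is a nonzero distribution on $B_{1+\epsilon}$, it is a quasinormal co-mode of Sobolev order $k+1$ at the frequency $s=-k-1$, and its support is contained in $S^2$; that is, it is concentrated on the cosmological horizon. -/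

import Mathlib

open MeasureTheory TopologicalSpace
open scoped Distributions ContDiff

namespace DeSitter

noncomputable section

/-- Euclidean three-space. -/
abbrev R3 : Type := EuclideanSpace ℝ (Fin 3)

/-- The open ball `B_{1+ε}` of radius `1 + ε` around the origin, as an open set. -/
def bigBall (ε : ℝ) : Opens R3 := ⟨Metric.ball (0 : R3) (1 + ε), Metric.isOpen_ball⟩

/-- Complex test functions `C_c^∞(B_{1+ε})`. -/
abbrev Test (ε : ℝ) : Type := 𝓓(bigBall ε, ℂ)

/-- Complex distributions on `B_{1+ε}`: continuous `ℂ`-linear functionals on `C_c^∞(B_{1+ε})` with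
its canonical LF topology. -/
abbrev Dist (ε : ℝ) : Type := Test ε →L[ℂ] ℂ

/-- The partial derivative `∂_i u`. -/
def pderiv (i : Fin 3) (u : R3 → ℂ) (x : R3) : ℂ := fderiv ℝ u x (EuclideanSpace.single i 1)

/-- The radial operator `∑ i, x_i ∂_i u = ρ ∂_ρ u`. -/
def euler (u : R3 → ℂ) (x : R3) : ℂ := ∑ i, (x i : ℂ) * pderiv i u x

/-- `L₀ u = -∑ i j, (δ_ij - x_i x_j) ∂_i ∂_j u + 4 ∑ i, x_i ∂_i u + 2 u`. -/
def opL0 (u : R3 → ℂ) (x : R3) : ℂ :=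
  -(∑ i, ∑ j, ((if i = j then 1 else 0) - (x i : ℂ) * (x j : ℂ)) * pderiv i (pderiv j u) x)
    + 4 * euler u x + 2 * u x

/-- `P u = ∑ i, x_i ∂_i u + (3/2) u`. -/
def opP (u : R3 → ℂ) (x : R3) : ℂ := euler u x + 3 / 2 * u x

/-- `L_s = L₀ + 2 s P + s²`. -/
def opL (s : ℂ) (u : R3 → ℂ) (x : R3) : ℂ := opL0 u x + 2 * s * opP u x + s ^ 2 * u x

theorem contDiff_pderiv {u : R3 → ℂ} (hu : ContDiff ℝ ∞ u) (i : Fin 3) :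
    ContDiff ℝ ∞ (pderiv i u) :=
  (hu.fderiv_right (m := ∞) (by simp)).clm_apply contDiff_const

theorem contDiff_coord (i : Fin 3) : ContDiff ℝ ∞ (fun x : R3 => (x i : ℂ)) :=
  Complex.ofRealCLM.contDiff.comp (EuclideanSpace.proj (𝕜 := ℝ) i).contDiff

theorem contDiff_euler {u : R3 → ℂ} (hu : ContDiff ℝ ∞ u) : ContDiff ℝ ∞ (euler u) :=
  ContDiff.sum fun i _ => (contDiff_coord i).mul (contDiff_pderiv hu i)

theorem contDiff_opL {u : R3 → ℂ} (s : ℂ) (hu : ContDiff ℝ ∞ u) : ContDiff ℝ ∞ (opL s u) := by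
  have hE := contDiff_euler hu
  have h0 : ContDiff ℝ ∞ (opL0 u) := by
    refine ((ContDiff.sum fun i _ => ContDiff.sum fun j _ => ?_).neg.add
      (contDiff_const.mul hE)).add (contDiff_const.mul hu)
    exact (contDiff_const.sub ((contDiff_coord i).mul (contDiff_coord j))).mul
      (contDiff_pderiv (contDiff_pderiv hu j) i)
  have hP : ContDiff ℝ ∞ (opP u) := hE.add (contDiff_const.mul hu)
  exact (h0.add (contDiff_const.mul hP)).add (contDiff_const.mul hu)

theorem pderiv_eq_zero {u : R3 → ℂ} {x : R3} (hx : x ∉ tsupport u) (i : Fin 3) :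
    pderiv i u x = 0 := by
  have h : fderiv ℝ u x = 0 :=
    image_eq_zero_of_notMem_tsupport fun h => hx (tsupport_fderiv_subset ℝ h)
  simp [pderiv, h]

theorem tsupport_pderiv_subset (u : R3 → ℂ) (i : Fin 3) : tsupport (pderiv i u) ⊆ tsupport u :=
  closure_minimal (fun _ hx => by_contra fun h => hx (pderiv_eq_zero h i)) (isClosed_tsupport u)

theorem tsupport_opL_subset (s : ℂ) (u : R3 → ℂ) : tsupport (opL s u) ⊆ tsupport u := by
  refine closure_minimal (fun x hx => by_contra fun h => hx ?_) (isClosed_tsupport u)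
  have h0 : u x = 0 := image_eq_zero_of_notMem_tsupport h
  have h2 : ∀ i j, pderiv i (pderiv j u) x = 0 := fun i j =>
    pderiv_eq_zero (fun hh => h (tsupport_pderiv_subset u j hh)) i
  simp [opL, opL0, opP, euler, h0, h2, pderiv_eq_zero h]

/-- `L_s` as a map from test functions to test functions. -/
def testL {ε : ℝ} (s : ℂ) (u : Test ε) : Test ε where
  toFun := opL s u
  contDiff' := contDiff_opL s u.contDiff
  hasCompactSupport' := u.hasCompactSupport.of_isClosed_subset (isClosed_tsupport _)
    (tsupport_opL_subset s u)
  tsupport_subset' := (tsupport_opL_subset s u).trans u.tsupport_subset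

/-- `∂^α u = ∂_1^{α_1} ∂_2^{α_2} ∂_3^{α_3} u` for a multi-index `α`. -/
def multiDeriv (α : Fin 3 → ℕ) (u : R3 → ℂ) : R3 → ℂ :=
  (pderiv 0)^[α 0] ((pderiv 1)^[α 1] ((pderiv 2)^[α 2] u))

/-- The norm of `H^m(B_1)` of (the restriction to the open unit ball of) a smooth function `u`:
the square root of the sum over all `|α| ≤ m` of `∫_{B_1} |∂^α u|²`. -/
def sobolevNorm (m : ℕ) (u : R3 → ℂ) : ℝ :=
  √(∑ j ∈ Finset.range (m + 1), ∑ α ∈ Finset.piAntidiag (Finset.univ : Finset (Fin 3)) j,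
    ∫ x in Metric.ball (0 : R3) 1, ‖multiDeriv α u x‖ ^ 2)

/-- `θ` is a quasinormal co-mode of Sobolev order `m` at the frequency `s`. The first condition
places `s` in the half-plane in which `L_s : D^{m+1}(L_s) → H^m(B_1)` is considered, which is
`Re s > 1/2 - (m + 1)`. -/
structure IsCoMode {ε : ℝ} (m : ℕ) (s : ℂ) (θ : Dist ε) : Prop where
  re_gt : 1 / 2 - ((m : ℝ) + 1) < s.re
  bounded : ∃ C : ℝ, 0 < C ∧ ∀ u : Test ε, ‖θ u‖ ≤ C * sobolevNorm m u
  annihilates : ∀ u : Test ε, θ (testL s u) = 0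

/-- The constant spherical harmonic `Y_00 = 1 / √(4π)`. -/
def Y00 : ℂ := ((1 / √(4 * Real.pi) : ℝ) : ℂ)

/-- `Θ_00 (f) = ∫_{S²} Y_00 f dσ`, with `σ` the standard surface measure of the unit sphere. -/
def Theta00 (f : R3 → ℂ) : ℂ :=
  ∫ x : Metric.sphere (0 : R3) 1, Y00 * f x ∂(volume : Measure R3).toSphere

/-- `D̃ u = ρ⁻¹ (∑ i, x_i ∂_i u + u) = ρ⁻¹ ∂_ρ (ρ u)`, for `x ≠ 0`. -/
def twistedD (u : R3 → ℂ) (x : R3) : ℂ := ((‖x‖⁻¹ : ℝ) : ℂ) * (euler u x + u x)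

/-- The value of `D̃^k Θ_00` at `f`. The operator `D̃` is formally anti-self-adjoint with respect to
Lebesgue measure, so `(D̃^k Θ_00)(f) = (-1)^k Θ_00(D̃^k f)`; here `D̃^k f` is smooth away from the
origin, and only its restriction to the unit sphere matters. -/
def twistedTheta (k : ℕ) (f : R3 → ℂ) : ℂ := (-1) ^ k * Theta00 (twistedD^[k] f)

end

end DeSitter

/-!
Write `E = ρ ∂_ρ`, and `∫_S` for the integral over the unit sphere. As `D̃ u = ρ⁻¹ (E + 1) u`, the
restriction of `D̃^k u` to the sphere is that of the falling product `(E + 1) E ⋯ (E + 2 - k) u`.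

For the equation, `L_s = -Δ + (E + s + 1) (E + s + 2)`, and at `s = -k - 1` the second summand is
`(E - k) (E + 1 - k)`, whose factors are the two that prolong the product to length `k + 2`. Moving
the product of length `k` past `Δ` shifts all its factors by `-2`, and rotation invariance gives
`∫_S Δ w = ∫_S (E + 1) E w`, which puts back the two missing factors. So both parts of `L_s`
contribute the same integral, with opposite signs.

The Sobolev bound comes from `∫_S u = ∫_{B_1} (E + 3) u`, each factor of the product costing one
derivative. Near the sphere a test function can be taken to be `ρ^(2k)`, an eigenfunction of `E`
on which every factor of the product is nonzero.
-/

namespace DeSitter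

noncomputable section

open Set Metric Filter Topology Module InnerProductSpace Laplacian Pointwise

section PolarCoordinates

variable {E F : Type*} [NormedAddCommGroup E] [NormedSpace ℝ E] [FiniteDimensional ℝ E]
  [MeasurableSpace E] [BorelSpace E] [NormedAddCommGroup F]

theorem integrable_toSphere_of_continuous (μ : Measure E) [μ.IsAddHaarMeasure] {g : E → F}
    (hg : Continuous g) : Integrable (fun ξ : sphere (0 : E) 1 => g ξ) μ.toSphere :=
  (hg.comp continuous_subtype_val).integrable_of_hasCompactSupport (.of_compactSpace _)

theorem integrable_restrict_prod_toSphere (μ : Measure E) [μ.IsAddHaarMeasure]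
    {f : ℝ × sphere (0 : E) 1 → F} (hf : Continuous f) (a b : ℝ) :
    Integrable f ((volume.restrict (uIoc a b)).prod μ.toSphere) := by
  have prod_eq : (volume.restrict (uIoc a b)).prod μ.toSphere =
      (volume.prod μ.toSphere).restrict (uIoc a b ×ˢ univ) := by
    rw [← Measure.prod_restrict, Measure.restrict_univ]
  rw [prod_eq]
  exact (hf.continuousOn.integrableOn_compact (isCompact_uIcc.prod isCompact_univ)).mono_set
    (prod_mono_left uIoc_subset_uIcc)

variable [NormedSpace ℝ F]

theorem integral_eq_integral_toSphere_integral_Ioi [Nontrivial E] (μ : Measure E)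
    [μ.IsAddHaarMeasure] {f : E → F} (hf : Integrable f μ) :
    ∫ x, f x ∂μ = ∫ ξ : sphere (0 : E) 1,
      (∫ r in Ioi (0 : ℝ), r ^ (finrank ℝ E - 1) • f (r • (ξ : E))) ∂μ.toSphere := by
  have polar_preserving := μ.measurePreserving_homeomorphUnitSphereProd
  have polar_embedding := (homeomorphUnitSphereProd E).measurableEmbedding
  let g : sphere (0 : E) 1 × Ioi (0 : ℝ) → F := fun p => f ((p.2 : ℝ) • (p.1 : E))
  have g_polar (x : ({0}ᶜ : Set E)) : g (homeomorphUnitSphereProd E x) = f x := by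
    have hx : ‖(x : E)‖ ≠ 0 := norm_ne_zero_iff.2 x.2
    simp [g, smul_smul, hx]
  have integrable_g : Integrable g (μ.toSphere.prod (.volumeIoiPow (finrank ℝ E - 1))) := by
    rw [← polar_preserving.integrable_comp_emb polar_embedding]
    have : IntegrableOn f {0}ᶜ μ := hf.integrableOn
    rw [integrableOn_iff_comap_subtypeVal (measurableSet_singleton _).compl] at this
    exact this.congr (.of_forall fun x => (g_polar x).symm)
  calc ∫ x, f x ∂μ = ∫ x : ({0}ᶜ : Set E), f x ∂(μ.comap Subtype.val) := by
        rw [integral_subtype_comap (measurableSet_singleton _).compl f, restrict_compl_singleton]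
    _ = ∫ p, g p ∂(μ.toSphere.prod (.volumeIoiPow (finrank ℝ E - 1))) := by
        rw [← polar_preserving.integral_comp polar_embedding]; simp only [g_polar]
    _ = ∫ ξ, ∫ r : Ioi (0 : ℝ), g (ξ, r) ∂(.volumeIoiPow (finrank ℝ E - 1)) ∂μ.toSphere :=
        integral_prod g integrable_g
    _ = _ := by
      simp only [Measure.volumeIoiPow, ENNReal.ofReal]
      refine integral_congr_ae (.of_forall fun ξ => ?_)
      dsimp only
      rw [integral_withDensity_eq_integral_smul (by fun_prop),
        integral_subtype_comap measurableSet_Ioi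
          fun r : ℝ => Real.toNNReal (r ^ (finrank ℝ E - 1)) • f (r • (ξ : E))]
      refine setIntegral_congr_fun measurableSet_Ioi fun r (hr : 0 < r) => ?_
      simp only [NNReal.smul_def, Real.coe_toNNReal _ (pow_pos hr _).le]

theorem setIntegral_ball_eq_integral_toSphere [Nontrivial E] (μ : Measure E) [μ.IsAddHaarMeasure]
    {f : E → F} {R : ℝ} (hf : IntegrableOn f (ball 0 R) μ) :
    ∫ x in ball 0 R, f x ∂μ = ∫ ξ : sphere (0 : E) 1,
      (∫ r in Ioo (0 : ℝ) R, r ^ (finrank ℝ E - 1) • f (r • (ξ : E))) ∂μ.toSphere := by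
  rw [← integral_indicator measurableSet_ball,
    integral_eq_integral_toSphere_integral_Ioi μ (hf.integrable_indicator measurableSet_ball)]
  refine integral_congr_ae (.of_forall fun ξ => ?_)
  dsimp only
  rw [← Ioi_inter_Iio, ← setIntegral_indicator measurableSet_Iio]
  refine setIntegral_congr_fun measurableSet_Ioi fun r (hr : 0 < r) => ?_
  have mem_ball_iff : r • (ξ : E) ∈ ball 0 R ↔ r ∈ Iio R := by
    simp [norm_smul, abs_of_pos hr]
  classical simp only [indicator_apply, mem_ball_iff, smul_ite, smul_zero]

end PolarCoordinates

section RadialDerivative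

variable {E F : Type*} [NormedAddCommGroup E] [NormedSpace ℝ E]
  [NormedAddCommGroup F] [NormedSpace ℝ F]

/-- The derivative of `u` along the identity vector field, `ρ ∂_ρ u`. On `ℝ³` it is `euler u`. -/
def radialDeriv (u : E → F) (x : E) : F := fderiv ℝ u x x

theorem contDiff_radialDeriv {u : E → F} (hu : ContDiff ℝ ∞ u) : ContDiff ℝ ∞ (radialDeriv u) :=
  (hu.fderiv_right (m := ∞) (by simp)).clm_apply contDiff_id

theorem hasDerivAt_comp_smul {u : E → F} {r : ℝ} {x : E} (hu : DifferentiableAt ℝ u (r • x)) :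
    HasDerivAt (fun t : ℝ => u (t • x)) (fderiv ℝ u (r • x) x) r := by
  simpa [Function.comp_def] using
    hu.hasFDerivAt.comp_hasDerivAt r ((hasDerivAt_id r).smul_const x)

theorem hasDerivAt_pow_smul_comp_smul {u : E → F} {r : ℝ} {x : E}
    (hu : DifferentiableAt ℝ u (r • x)) (n : ℕ) :
    HasDerivAt (fun t : ℝ => t ^ (n + 1) • u (t • x))
      (r ^ n • (radialDeriv u (r • x) + ((n + 1 : ℕ) : ℝ) • u (r • x))) r := by
  refine ((hasDerivAt_pow (n + 1) r).smul (hasDerivAt_comp_smul hu)).congr_deriv ?_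
  rw [radialDeriv, map_smul]
  simp only [add_tsub_cancel_right, smul_add, smul_smul]
  ring_nf

/-- This is the divergence theorem for the vector field `x ↦ u x • x`. -/
theorem integral_toSphere_eq_setIntegral_ball [FiniteDimensional ℝ E] [Nontrivial E]
    [MeasurableSpace E] [BorelSpace E] [CompleteSpace F] (μ : Measure E) [μ.IsAddHaarMeasure]
    {u : E → F} (hu : ContDiff ℝ 1 u) :
    ∫ ξ : sphere (0 : E) 1, u ξ ∂μ.toSphere =
      ∫ x in ball 0 1, (radialDeriv u x + (finrank ℝ E : ℝ) • u x) ∂μ := by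
  have continuous_fderiv : Continuous (fderiv ℝ u) := hu.continuous_fderiv one_ne_zero
  have continuous_integrand : Continuous fun x => radialDeriv u x + (finrank ℝ E : ℝ) • u x :=
    (continuous_fderiv.clm_apply continuous_id).add (hu.continuous.const_smul _)
  rw [setIntegral_ball_eq_integral_toSphere μ
    ((continuous_integrand.continuousOn.integrableOn_compact (isCompact_closedBall 0 1)).mono_set
      ball_subset_closedBall)]
  refine integral_congr_ae (.of_forall fun ξ => ?_)
  obtain ⟨n, hn⟩ := Nat.exists_eq_add_one.2 (finrank_pos (R := ℝ) (M := E))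
  dsimp only
  rw [hn] at continuous_integrand ⊢
  rw [add_tsub_cancel_right, ← integral_Ioc_eq_integral_Ioo,
    ← intervalIntegral.integral_of_le zero_le_one,
    intervalIntegral.integral_eq_sub_of_hasDerivAt
      (fun r _ => hasDerivAt_pow_smul_comp_smul (hu.differentiable one_ne_zero _) n)
      (Continuous.intervalIntegrable ((continuous_pow n).smul
        (continuous_integrand.comp (continuous_id.smul continuous_const))) 0 1)]
  simp

end RadialDerivative

section SphereRotations

variable {E F : Type*} [NormedAddCommGroup E] [InnerProductSpace ℝ E]
  [NormedAddCommGroup F] [NormedSpace ℝ F]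

theorem exists_isometry_eq_exp_of_skew [CompleteSpace E] {A : E →L[ℝ] E}
    (hA : ∀ x y, ⟪A x, y⟫_ℝ = -⟪x, A y⟫_ℝ) (t : ℝ) :
    ∃ R : E ≃ₗᵢ[ℝ] E, ∀ x, R x = NormedSpace.exp (t • A) x := by
  let : NormedAlgebra ℚ (E →L[ℝ] E) := .restrictScalars ℚ ℝ _
  have skew : A ∈ skewAdjoint (E →L[ℝ] E) := by
    rw [skewAdjoint.mem_iff, ContinuousLinearMap.star_eq_adjoint, eq_comm,
      ContinuousLinearMap.eq_adjoint_iff]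
    intro x y
    rw [neg_apply, inner_neg_left, hA, neg_neg]
  have unitary := NormedSpace.exp_mem_unitary_of_mem_skewAdjoint (skewAdjoint.smul_mem t skew)
  exact ⟨Unitary.linearIsometryEquiv ⟨_, unitary⟩, fun _ => rfl⟩

/-- The action of a linear isometry on the unit sphere. -/
def sphereHomeomorph (R : E ≃ₗᵢ[ℝ] E) : sphere (0 : E) 1 ≃ₜ sphere (0 : E) 1 :=
  R.toHomeomorph.subtype fun x => by simp

theorem coe_sphereHomeomorph (R : E ≃ₗᵢ[ℝ] E) (ξ : sphere (0 : E) 1) :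
    (sphereHomeomorph R ξ : E) = R ξ := rfl

variable [FiniteDimensional ℝ E]

theorem exists_isometry_flow_of_skew {A : E →L[ℝ] E} (hA : ∀ x y, ⟪A x, y⟫_ℝ = -⟪x, A y⟫_ℝ) :
    ∃ R : ℝ → E ≃ₗᵢ[ℝ] E, (Continuous fun p : ℝ × E => R p.1 p.2) ∧
      ∀ x t, HasDerivAt (fun t => R t x) (A (R t x)) t := by
  have := FiniteDimensional.complete ℝ E
  choose R hR using exists_isometry_eq_exp_of_skew hA
  have hasDerivAt_exp (t : ℝ) := hasDerivAt_exp_smul_const' (𝕂 := ℝ) A t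
  refine ⟨R, ?_, fun x t => ?_⟩
  · simp only [hR]
    have continuous_exp : Continuous fun t : ℝ => NormedSpace.exp (t • A) :=
      continuous_iff_continuousAt.2 fun t => (hasDerivAt_exp t).continuousAt
    exact (continuous_exp.comp continuous_fst).clm_apply continuous_snd
  · simpa [hR] using (hasDerivAt_exp t).clm_apply (hasDerivAt_const t x)

variable [MeasurableSpace E] [BorelSpace E]

theorem measurePreserving_sphereHomeomorph (R : E ≃ₗᵢ[ℝ] E) :
    MeasurePreserving (sphereHomeomorph R) (volume : Measure E).toSphere
      (volume : Measure E).toSphere := by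
  have hR := (sphereHomeomorph R).continuous.measurable
  refine ⟨hR, Measure.ext fun s hs => ?_⟩
  have cone_preimage : Ioo (0 : ℝ) 1 • ((↑) '' (sphereHomeomorph R ⁻¹' s) : Set E) =
      R ⁻¹' (Ioo (0 : ℝ) 1 • ((↑) '' s)) := by
    ext x
    simp only [mem_preimage, Set.mem_smul]
    constructor
    · rintro ⟨t, ht, _, ⟨ξ, hξ, rfl⟩, rfl⟩
      exact ⟨t, ht, _, ⟨_, hξ, rfl⟩, by rw [coe_sphereHomeomorph, map_smul]⟩
    · rintro ⟨t, ht, _, ⟨η, hη, rfl⟩, hx⟩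
      obtain ⟨ξ, rfl⟩ := (sphereHomeomorph R).surjective η
      exact ⟨t, ht, _, ⟨ξ, hη, rfl⟩, R.injective (by rw [map_smul, ← hx, coe_sphereHomeomorph])⟩
  rw [Measure.map_apply hR hs, Measure.toSphere_apply' _ (hR hs), Measure.toSphere_apply' _ hs,
    cone_preimage]
  exact congrArg _ (R.measurePreserving.measure_preimage_equiv (f := R.toMeasurableEquiv) _)

theorem integral_toSphere_comp_isometry (R : E ≃ₗᵢ[ℝ] E) (g : E → F) :
    ∫ ξ : sphere (0 : E) 1, g (R ξ) ∂(volume : Measure E).toSphere =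
      ∫ ξ : sphere (0 : E) 1, g ξ ∂(volume : Measure E).toSphere :=
  (measurePreserving_sphereHomeomorph R).integral_comp
    (sphereHomeomorph R).measurableEmbedding (fun ξ => g ξ)

/-- The rotations `exp (t A)` preserve the surface measure, so the mean of `g ∘ exp (t A)` does not
depend on `t`. -/
theorem integral_toSphere_fderiv_skew [CompleteSpace F] {A : E →L[ℝ] E}
    (hA : ∀ x y, ⟪A x, y⟫_ℝ = -⟪x, A y⟫_ℝ) {g : E → F} (hg : ContDiff ℝ 1 g) :
    ∫ ξ : sphere (0 : E) 1, fderiv ℝ g ξ (A ξ) ∂(volume : Measure E).toSphere = 0 := by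
  obtain ⟨R, continuous_flow, hasDerivAt_flow⟩ := exists_isometry_flow_of_skew hA
  let D : E → F := fun x => fderiv ℝ g x (A x)
  have continuous_D : Continuous fun p : ℝ × sphere (0 : E) 1 => D (R p.1 p.2) :=
    ((hg.continuous_fderiv one_ne_zero).clm_apply A.continuous).comp
      (continuous_flow.comp (continuous_fst.prodMk (continuous_subtype_val.comp continuous_snd)))
  have hasDerivAt_comp_flow (x : E) (t : ℝ) : HasDerivAt (fun t => g (R t x)) (D (R t x)) t :=
    (hg.differentiable one_ne_zero _).hasFDerivAt.comp_hasDerivAt t (hasDerivAt_flow x t)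
  have ftc (ξ : sphere (0 : E) 1) : ∫ t in (0 : ℝ)..1, D (R t ξ) = g (R 1 ξ) - g (R 0 ξ) :=
    intervalIntegral.integral_eq_sub_of_hasDerivAt (fun t _ => hasDerivAt_comp_flow ξ t)
      ((continuous_D.comp (.prodMk_left ξ)).intervalIntegrable 0 1)
  have integrable_comp (t : ℝ) : Integrable (fun ξ : sphere (0 : E) 1 => g (R t ξ))
      (volume : Measure E).toSphere :=
    integrable_toSphere_of_continuous _ (hg.continuous.comp (R t).continuous)
  calc ∫ ξ : sphere (0 : E) 1, D ξ ∂(volume : Measure E).toSphere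
      = ∫ t in (0 : ℝ)..1, ∫ ξ : sphere (0 : E) 1, D (R t ξ) ∂(volume : Measure E).toSphere := by
        simp [integral_toSphere_comp_isometry]
    _ = ∫ ξ : sphere (0 : E) 1, (∫ t in (0 : ℝ)..1, D (R t ξ)) ∂(volume : Measure E).toSphere :=
        intervalIntegral_integral_swap
          (integrable_restrict_prod_toSphere _ continuous_D 0 1)
    _ = 0 := by
        simp only [ftc]
        rw [integral_sub (integrable_comp 1) (integrable_comp 0),
          integral_toSphere_comp_isometry, integral_toSphere_comp_isometry, sub_self]

end SphereRotations

section SecondDerivatives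

variable {E F : Type*} [NormedAddCommGroup E] [NormedSpace ℝ E]
  [NormedAddCommGroup F] [NormedSpace ℝ F]

theorem differentiable_fderiv {u : E → F} (hu : ContDiff ℝ 2 u) :
    Differentiable ℝ (fderiv ℝ u) :=
  (hu.fderiv_right (m := 1) (by norm_num)).differentiable one_ne_zero

theorem fderiv_fderiv_apply_const {u : E → F} (hu : ContDiff ℝ 2 u) (v w x : E) :
    fderiv ℝ (fun y => fderiv ℝ u y v) x w = fderiv ℝ (fderiv ℝ u) x w v := by
  rw [fderiv_clm_apply (differentiable_fderiv hu x) (differentiableAt_const v)]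
  simp

theorem fderiv_fderiv_comm {u : E → F} (hu : ContDiff ℝ 2 u) (x v w : E) :
    fderiv ℝ (fderiv ℝ u) x v w = fderiv ℝ (fderiv ℝ u) x w v :=
  (hu.contDiffAt.isSymmSndFDerivAt (by simp)).eq v w

theorem fderiv_radialDeriv_apply {u : E → F} (hu : ContDiff ℝ 2 u) (x v : E) :
    fderiv ℝ (radialDeriv u) x v = radialDeriv (fun y => fderiv ℝ u y v) x + fderiv ℝ u x v := by
  rw [radialDeriv, fderiv_fderiv_apply_const hu, fderiv_fderiv_comm hu,
    show radialDeriv u = fun y => fderiv ℝ u y y from rfl,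
    fderiv_clm_apply (differentiable_fderiv hu x) differentiableAt_fun_id]
  simp [add_comm]

theorem radialDeriv_radialDeriv {u : E → F} (hu : ContDiff ℝ 2 u) (x : E) :
    radialDeriv (radialDeriv u) x = fderiv ℝ (fderiv ℝ u) x x x + radialDeriv u x := by
  rw [radialDeriv, fderiv_radialDeriv_apply hu, radialDeriv, fderiv_fderiv_apply_const hu,
    radialDeriv]

end SecondDerivatives

section SphereLaplacian

variable {E F : Type*} [NormedAddCommGroup E] [InnerProductSpace ℝ E]
  [NormedAddCommGroup F] [NormedSpace ℝ F]

/-- The infinitesimal rotation `x ↦ ⟪a, x⟫ b - ⟪b, x⟫ a` in the plane of `a` and `b`. -/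
def planeRotation (a b : E) : E →L[ℝ] E := rankOne ℝ b a - rankOne ℝ a b

theorem planeRotation_apply (a b x : E) :
    planeRotation a b x = ⟪a, x⟫_ℝ • b - ⟪b, x⟫_ℝ • a := rfl

theorem inner_planeRotation_left (a b x y : E) :
    ⟪planeRotation a b x, y⟫_ℝ = -⟪x, planeRotation a b y⟫_ℝ := by
  simp only [planeRotation_apply, inner_sub_left, inner_sub_right, real_inner_smul_left,
    real_inner_smul_right, real_inner_comm x]
  ring

theorem fderiv_inner_smul_fderiv_apply {u : E → F} (hu : ContDiff ℝ 2 u) (a b x v : E) :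
    fderiv ℝ (fun y => ⟪a, y⟫_ℝ • fderiv ℝ u y b) x v =
      ⟪a, v⟫_ℝ • fderiv ℝ u x b + ⟪a, x⟫_ℝ • fderiv ℝ (fderiv ℝ u) x v b := by
  have hasFDerivAt_deriv := ((differentiable_fderiv hu x).clm_apply
    (differentiableAt_const b)).hasFDerivAt
  rw [(HasFDerivAt.fun_smul (c := fun y => ⟪a, y⟫_ℝ) (innerSL ℝ a).hasFDerivAt
    hasFDerivAt_deriv).fderiv]
  simp [fderiv_fderiv_apply_const hu, add_comm]

theorem sum_inner_smul_map {ι : Type*} [Fintype ι] (b : OrthonormalBasis ι ℝ E) (T : E →L[ℝ] F)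
    (x : E) : ∑ i, ⟪b i, x⟫_ℝ • T (b i) = T x := by
  simp only [← map_smul, ← map_sum, b.sum_repr']

variable [FiniteDimensional ℝ E]

theorem laplacian_eq_sum_fderiv {ι : Type*} [Fintype ι] (b : OrthonormalBasis ι ℝ E) (u : E → F)
    (x : E) : Δ u x = ∑ i, fderiv ℝ (fderiv ℝ u) x (b i) (b i) := by
  simp [laplacian_eq_iteratedFDeriv_orthonormalBasis u b, iteratedFDeriv_two_apply]

theorem sum_fderiv_planeRotation {ι : Type*} [Fintype ι] (b : OrthonormalBasis ι ℝ E)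
    {u : E → F} (hu : ContDiff ℝ 2 u) (x : E) :
    ∑ i, ∑ j, fderiv ℝ (fun y => ⟪b i, y⟫_ℝ • fderiv ℝ u y (b j)) x
        (planeRotation (b i) (b j) x) =
      ‖x‖ ^ 2 • Δ u x -
        (radialDeriv (radialDeriv u) x + ((finrank ℝ E : ℝ) - 2) • radialDeriv u x) := by
  have first_order (i : ι) : ∑ j, ⟪b i, planeRotation (b i) (b j) x⟫_ℝ • fderiv ℝ u x (b j) =
      ⟪b i, x⟫_ℝ • fderiv ℝ u x (b i) - radialDeriv u x := by
    simp only [planeRotation_apply, inner_sub_right, real_inner_smul_right, sub_smul, mul_smul,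
      Finset.sum_sub_distrib, real_inner_comm (b _) (b i), ← Finset.smul_sum, sum_inner_smul_map,
      inner_self_eq_norm_sq_to_K, b.norm_eq_one]
    simp [sum_inner_smul_map, radialDeriv]
  have second_order (i : ι) :
      ∑ j, ⟪b i, x⟫_ℝ • fderiv ℝ (fderiv ℝ u) x (planeRotation (b i) (b j) x) (b j) =
        ⟪b i, x⟫_ℝ ^ 2 • Δ u x - ⟪b i, x⟫_ℝ • (fderiv ℝ (fderiv ℝ u) x).flip x (b i) := by
    simp only [planeRotation_apply, map_sub, map_smul, sub_apply, smul_apply,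
      Finset.sum_sub_distrib, ← Finset.smul_sum, sum_inner_smul_map, laplacian_eq_sum_fderiv b,
      ContinuousLinearMap.flip_apply, smul_sub, sq, mul_smul]
  simp only [fderiv_inner_smul_fderiv_apply hu, Finset.sum_add_distrib, first_order, second_order,
    Finset.sum_sub_distrib, sum_inner_smul_map, ← Finset.sum_smul, b.sum_sq_inner_right,
    Finset.sum_const, Finset.card_univ, ← finrank_eq_card_basis b.toBasis,
    radialDeriv_radialDeriv hu]
  simp only [radialDeriv, ContinuousLinearMap.flip_apply]
  module

theorem contDiff_laplacian {u : E → F} (hu : ContDiff ℝ ∞ u) : ContDiff ℝ ∞ (Δ u) := by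
  have contDiff_snd : ContDiff ℝ ∞ (fderiv ℝ (fderiv ℝ u)) :=
    (hu.fderiv_right (m := ∞) (by simp)).fderiv_right (m := ∞) (by simp)
  rw [funext (laplacian_eq_sum_fderiv (stdOrthonormalBasis ℝ E) u)]
  exact ContDiff.sum fun i _ => (contDiff_snd.clm_apply contDiff_const).clm_apply contDiff_const

variable [MeasurableSpace E] [BorelSpace E] [CompleteSpace F]

theorem integral_toSphere_sum_fderiv_planeRotation {ι : Type*} [Fintype ι]
    (b : OrthonormalBasis ι ℝ E) {u : E → F} (hu : ContDiff ℝ 2 u) :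
    ∫ ξ : sphere (0 : E) 1, ∑ i, ∑ j, fderiv ℝ (fun y => ⟪b i, y⟫_ℝ • fderiv ℝ u y (b j)) ξ
      (planeRotation (b i) (b j) ξ) ∂(volume : Measure E).toSphere = 0 := by
  have contDiff_field (i j : ι) : ContDiff ℝ 1 fun y => ⟪b i, y⟫_ℝ • fderiv ℝ u y (b j) :=
    (innerSL ℝ (b i)).contDiff.smul
      ((hu.fderiv_right (m := 1) (by norm_num)).clm_apply contDiff_const)
  have integrable_field (i j : ι) := integrable_toSphere_of_continuous (volume : Measure E)
    (((contDiff_field i j).continuous_fderiv one_ne_zero).clm_apply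
      (planeRotation (b i) (b j)).continuous)
  rw [integral_finsetSum _ fun i _ => integrable_finsetSum _ fun j _ => integrable_field i j]
  refine Finset.sum_eq_zero fun i _ => ?_
  rw [integral_finsetSum _ fun j _ => integrable_field i j]
  exact Finset.sum_eq_zero fun j _ =>
    integral_toSphere_fderiv_skew (inner_planeRotation_left _ _) (contDiff_field i j)

theorem integral_toSphere_laplacian {u : E → F} (hu : ContDiff ℝ ∞ u) :
    ∫ ξ : sphere (0 : E) 1, Δ u ξ ∂(volume : Measure E).toSphere =
      ∫ ξ : sphere (0 : E) 1,
        (radialDeriv (radialDeriv u) ξ + ((finrank ℝ E : ℝ) - 2) • radialDeriv u ξ)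
          ∂(volume : Measure E).toSphere := by
  have hu₂ : ContDiff ℝ 2 u := hu.of_le (WithTop.coe_le_coe.2 le_top)
  have integrable_radial := integrable_toSphere_of_continuous (volume : Measure E)
    ((contDiff_radialDeriv (contDiff_radialDeriv hu)).continuous.add
      ((contDiff_radialDeriv hu).continuous.const_smul ((finrank ℝ E : ℝ) - 2)))
  have integrable_laplacian := integrable_toSphere_of_continuous (volume : Measure E)
    (contDiff_laplacian hu).continuous
  rw [← sub_eq_zero, ← integral_toSphere_sum_fderiv_planeRotation (stdOrthonormalBasis ℝ E) hu₂]
  refine (integral_sub integrable_laplacian integrable_radial).symm.trans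
    (integral_congr_ae (.of_forall fun ξ => ?_))
  dsimp only
  rw [sum_fderiv_planeRotation _ hu₂, norm_eq_of_mem_sphere, one_pow, one_smul]
  rfl

end SphereLaplacian

section ShiftedEuler

variable {E F : Type*} [NormedAddCommGroup E] [NormedSpace ℝ E]
  [NormedAddCommGroup F] [NormedSpace ℂ F]

/-- The operator `ρ ∂_ρ + c`. -/
def eulerShift (c : ℂ) (u : E → F) (x : E) : F := radialDeriv u x + c • u x

theorem contDiff_eulerShift (c : ℂ) {u : E → F} (hu : ContDiff ℝ ∞ u) :
    ContDiff ℝ ∞ (eulerShift c u) :=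
  (contDiff_radialDeriv hu).add (hu.const_smul c)

theorem eulerShift_add (c : ℂ) {u v : E → F} (hu : Differentiable ℝ u) (hv : Differentiable ℝ v) :
    eulerShift c (u + v) = eulerShift c u + eulerShift c v := by
  ext x
  simp only [eulerShift, radialDeriv, fderiv_add (hu x) (hv x), add_apply, Pi.add_apply]
  module

theorem eulerShift_const_smul (c a : ℂ) {u : E → F} (hu : Differentiable ℝ u) :
    eulerShift c (a • u) = a • eulerShift c u := by
  ext x
  simp only [eulerShift, radialDeriv, fderiv_const_smul (hu x), smul_apply, Pi.smul_apply]
  module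

theorem eulerShift_sum (c : ℂ) {ι : Type*} {s : Finset ι} {u : ι → E → F}
    (hu : ∀ i ∈ s, Differentiable ℝ (u i)) :
    eulerShift c (fun x => ∑ i ∈ s, u i x) = fun x => ∑ i ∈ s, eulerShift c (u i) x := by
  ext x
  simp only [eulerShift, radialDeriv, fderiv_fun_sum fun i hi => hu i hi x,
    sum_apply, Finset.smul_sum, Finset.sum_add_distrib]

theorem eulerShift_comm (a b : ℂ) {u : E → F} (hu : ContDiff ℝ ∞ u) :
    eulerShift a (eulerShift b u) = eulerShift b (eulerShift a u) := by
  have hu' := hu.differentiable (by simp)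
  have hE := (contDiff_radialDeriv hu).differentiable (by simp)
  have expand (c : ℂ) : eulerShift c u = radialDeriv u + c • u := rfl
  rw [expand b, eulerShift_add a hE (hu'.const_smul b), eulerShift_const_smul a b hu', expand a,
    eulerShift_add b hE (hu'.const_smul a), eulerShift_const_smul b a hu']
  ext x
  simp only [eulerShift, Pi.add_apply, Pi.smul_apply]
  module

theorem fderiv_eulerShift_apply (c : ℂ) {u : E → F} (hu : ContDiff ℝ 2 u) (v : E) :
    (fun x => fderiv ℝ (eulerShift c u) x v) = eulerShift (c + 1) (fun x => fderiv ℝ u x v) := by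
  ext x
  have hE : DifferentiableAt ℝ (radialDeriv u) x :=
    (differentiable_fderiv hu x).clm_apply differentiableAt_fun_id
  have hu' : DifferentiableAt ℝ u x := hu.differentiable two_ne_zero x
  rw [show eulerShift c u = radialDeriv u + c • u from rfl, fderiv_add hE (hu'.const_smul c),
    fderiv_const_smul hu', add_apply, fderiv_radialDeriv_apply hu, smul_apply, eulerShift]
  module

/-- The falling product `(ρ ∂_ρ + c) (ρ ∂_ρ + c - 1) ⋯ (ρ ∂_ρ + c - k + 1)`. -/
def fallingEuler (c : ℂ) : ℕ → (E → F) → E → F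
  | 0, u => u
  | k + 1, u => eulerShift (c - k) (fallingEuler c k u)

theorem contDiff_fallingEuler (c : ℂ) (k : ℕ) {u : E → F} (hu : ContDiff ℝ ∞ u) :
    ContDiff ℝ ∞ (fallingEuler c k u) := by
  induction k with
  | zero => exact hu
  | succ k ih => exact contDiff_eulerShift _ ih

theorem fallingEuler_add (c : ℂ) (k : ℕ) {u v : E → F} (hu : ContDiff ℝ ∞ u)
    (hv : ContDiff ℝ ∞ v) :
    fallingEuler c k (u + v) = fallingEuler c k u + fallingEuler c k v := by
  induction k with
  | zero => rfl
  | succ k ih =>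
    rw [fallingEuler, ih, eulerShift_add _
      ((contDiff_fallingEuler c k hu).differentiable (by simp))
      ((contDiff_fallingEuler c k hv).differentiable (by simp))]
    rfl

theorem fallingEuler_const_smul (c a : ℂ) (k : ℕ) {u : E → F} (hu : ContDiff ℝ ∞ u) :
    fallingEuler c k (a • u) = a • fallingEuler c k u := by
  induction k with
  | zero => rfl
  | succ k ih =>
    rw [fallingEuler, ih, eulerShift_const_smul _ _
      ((contDiff_fallingEuler c k hu).differentiable (by simp))]
    rfl

theorem fallingEuler_eulerShift (a c : ℂ) (k : ℕ) {u : E → F} (hu : ContDiff ℝ ∞ u) :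
    fallingEuler c k (eulerShift a u) = eulerShift a (fallingEuler c k u) := by
  induction k with
  | zero => rfl
  | succ k ih => rw [fallingEuler, ih, eulerShift_comm _ _ (contDiff_fallingEuler c k hu)]; rfl

theorem fallingEuler_fallingEuler (c : ℂ) (m k : ℕ) {u : E → F} (hu : ContDiff ℝ ∞ u) :
    fallingEuler c m (fallingEuler (c - m) k u) = fallingEuler c (m + k) u := by
  induction k with
  | zero => rfl
  | succ k ih =>
    rw [fallingEuler, fallingEuler_eulerShift _ _ _ (contDiff_fallingEuler _ k hu), ih,
      ← add_assoc, fallingEuler, Nat.cast_add, sub_sub]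

theorem eventuallyEq_radialDeriv {u v : E → F} {x : E} (h : u =ᶠ[𝓝 x] v) :
    radialDeriv u =ᶠ[𝓝 x] radialDeriv v := by
  filter_upwards [h.fderiv (𝕜 := ℝ)] with y hy using by rw [radialDeriv, hy, radialDeriv]

theorem fallingEuler_eventuallyEq_of_homogeneous (c d : ℂ) (k : ℕ) {u : E → F} {x : E}
    (hu : Differentiable ℝ u) (h : radialDeriv u =ᶠ[𝓝 x] d • u) :
    fallingEuler c k u =ᶠ[𝓝 x] (∏ j ∈ Finset.range k, (c - j + d)) • u := by
  induction k with
  | zero => simp [fallingEuler]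
  | succ k ih =>
    set p := ∏ j ∈ Finset.range k, (c - j + d) with hp
    filter_upwards [ih, eventuallyEq_radialDeriv ih, h] with y falling_eq deriv_eq radial_eq
    rw [fallingEuler, eulerShift, deriv_eq, falling_eq, radialDeriv,
      fderiv_const_smul (hu y), smul_apply, ← radialDeriv, radial_eq, Finset.prod_range_succ, ← hp]
    simp only [Pi.smul_apply]
    module

end ShiftedEuler

section LaplacianCommutation

variable {E F : Type*} [NormedAddCommGroup E] [InnerProductSpace ℝ E] [FiniteDimensional ℝ E]
  [NormedAddCommGroup F] [NormedSpace ℂ F]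

theorem laplacian_eulerShift (c : ℂ) {u : E → F} (hu : ContDiff ℝ ∞ u) :
    Δ (eulerShift c u) = eulerShift (c + 2) (Δ u) := by
  let b := stdOrthonormalBasis ℝ E
  have contDiff_deriv {w : E → F} (hw : ContDiff ℝ ∞ w) (v : E) :
      ContDiff ℝ ∞ fun x => fderiv ℝ w x v :=
    (hw.fderiv_right (m := ∞) (by simp)).clm_apply contDiff_const
  have contDiff_two {w : E → F} (hw : ContDiff ℝ ∞ w) : ContDiff ℝ 2 w :=
    hw.of_le (WithTop.coe_le_coe.2 le_top)
  have laplacian_eq {w : E → F} (hw : ContDiff ℝ ∞ w) :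
      Δ w = fun x => ∑ i, fderiv ℝ (fun y => fderiv ℝ w y (b i)) x (b i) := by
    ext x
    simp only [laplacian_eq_sum_fderiv b, fderiv_fderiv_apply_const (contDiff_two hw)]
  rw [laplacian_eq (contDiff_eulerShift c hu), laplacian_eq hu, eulerShift_sum _ fun i _ =>
    (contDiff_deriv (contDiff_deriv hu (b i)) (b i)).differentiable (by simp)]
  ext x
  refine Finset.sum_congr rfl fun i _ => ?_
  rw [fderiv_eulerShift_apply c (contDiff_two hu) (b i),
    congrFun (fderiv_eulerShift_apply (c + 1) (contDiff_two (contDiff_deriv hu (b i))) (b i)) x,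
    show c + 1 + 1 = c + 2 by ring]

theorem fallingEuler_laplacian (c : ℂ) (k : ℕ) {u : E → F} (hu : ContDiff ℝ ∞ u) :
    fallingEuler c k (Δ u) = Δ (fallingEuler (c - 2) k u) := by
  induction k with
  | zero => rfl
  | succ k ih =>
    rw [fallingEuler, ih, fallingEuler, laplacian_eulerShift _ (contDiff_fallingEuler _ k hu),
      show c - 2 - k + 2 = c - k by ring]

end LaplacianCommutation

theorem radialDeriv_zpow_norm_smul {E F : Type*} [NormedAddCommGroup E] [InnerProductSpace ℝ E]
    [NormedAddCommGroup F] [NormedSpace ℝ F] (n : ℤ) {u : E → F} {x : E} (hx : x ≠ 0)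
    (hu : DifferentiableAt ℝ u x) :
    radialDeriv (fun y => ‖y‖ ^ n • u y) x = ‖x‖ ^ n • (radialDeriv u x + (n : ℝ) • u x) := by
  have hx' : ‖x‖ ≠ 0 := norm_ne_zero_iff.2 hx
  have hnorm : DifferentiableAt ℝ (‖·‖) x := (contDiffAt_norm ℝ hx).differentiableAt one_ne_zero
  have hpow : HasFDerivAt (fun y : E => ‖y‖ ^ n) ((n * ‖x‖ ^ (n - 1)) • fderiv ℝ (‖·‖) x) x :=
    (hasDerivAt_zpow n ‖x‖ (.inl hx')).comp_hasFDerivAt x hnorm.hasFDerivAt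
  rw [radialDeriv, (hpow.fun_smul hu.hasFDerivAt).fderiv]
  simp only [add_apply, smul_apply, ContinuousLinearMap.smulRight_apply,
    hnorm.fderiv_norm_self, smul_eq_mul]
  rw [mul_assoc, ← zpow_add_one₀ hx', sub_add_cancel, radialDeriv]
  module

theorem radialDeriv_norm_pow {E : Type*} [NormedAddCommGroup E] [InnerProductSpace ℝ E] (n : ℕ)
    {x : E} (hx : x ≠ 0) : radialDeriv (fun y : E => (‖y‖ : ℂ) ^ n) x = n * (‖x‖ : ℂ) ^ n := by
  have radial := radialDeriv_zpow_norm_smul n hx (differentiableAt_const (1 : ℂ))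
  simpa [radialDeriv, mul_comm] using radial

section EuclideanSpace

theorem sum_coord_mul_map_single (T : R3 →L[ℝ] ℂ) (x : R3) :
    ∑ i, (x i : ℂ) * T (EuclideanSpace.single i 1) = T x := by
  simpa [EuclideanSpace.inner_single_left] using
    sum_inner_smul_map (EuclideanSpace.basisFun (Fin 3) ℝ) T x

theorem euler_eq_radialDeriv (u : R3 → ℂ) : euler u = radialDeriv u :=
  funext fun x => sum_coord_mul_map_single (fderiv ℝ u x) x

theorem twistedD_iterate_eqOn (k : ℕ) {u : R3 → ℂ} (hu : ContDiff ℝ ∞ u) :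
    EqOn (twistedD^[k] u) (fun x => ‖x‖ ^ (-k : ℤ) • fallingEuler 1 k u x) {0}ᶜ := by
  induction k with
  | zero => intro x _; simp [fallingEuler]
  | succ k ih =>
    intro x hx
    have hw := (contDiff_fallingEuler 1 k hu).differentiable (by simp) x
    have heq := ih.eventuallyEq_of_mem (isOpen_compl_singleton.mem_nhds hx)
    rw [Function.iterate_succ_apply', twistedD, euler_eq_radialDeriv,
      (eventuallyEq_radialDeriv heq).eq_of_nhds, heq.eq_of_nhds,
      radialDeriv_zpow_norm_smul _ hx hw]
    simp only [fallingEuler, eulerShift, Complex.real_smul, smul_eq_mul,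
      show (-(k + 1 : ℕ) : ℤ) = -1 + -k by push_cast; ring,
      zpow_add₀ (norm_ne_zero_iff.2 hx), zpow_neg_one]
    push_cast
    ring

theorem twistedTheta_eq_integral_fallingEuler (k : ℕ) {u : R3 → ℂ} (hu : ContDiff ℝ ∞ u) :
    twistedTheta k u = (-1) ^ k * Y00 *
      ∫ ξ : sphere (0 : R3) 1, fallingEuler 1 k u ξ ∂(volume : Measure R3).toSphere := by
  have on_sphere (ξ : sphere (0 : R3) 1) : twistedD^[k] u ξ = fallingEuler 1 k u ξ := by
    simp [twistedD_iterate_eqOn k hu (ne_zero_of_mem_unit_sphere ξ)]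
  simp only [twistedTheta, Theta00, on_sphere, integral_const_mul, mul_assoc]

theorem laplacian_eq_sum_pderiv {u : R3 → ℂ} (hu : ContDiff ℝ 2 u) (x : R3) :
    Δ u x = ∑ i, pderiv i (pderiv i u) x := by
  rw [laplacian_eq_sum_fderiv (EuclideanSpace.basisFun (Fin 3) ℝ)]
  simp only [EuclideanSpace.basisFun_apply, ← fderiv_fderiv_apply_const hu]
  rfl

theorem sum_mul_pderiv_pderiv {u : R3 → ℂ} (hu : ContDiff ℝ 2 u) (x : R3) :
    ∑ i, ∑ j, (x i : ℂ) * x j * pderiv i (pderiv j u) x =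
      radialDeriv (radialDeriv u) x - radialDeriv u x := by
  have pderiv_eq (i j : Fin 3) : pderiv i (pderiv j u) x =
      fderiv ℝ (fderiv ℝ u) x (EuclideanSpace.single i 1) (EuclideanSpace.single j 1) :=
    fderiv_fderiv_apply_const hu _ _ x
  simp only [pderiv_eq, mul_assoc, ← Finset.mul_sum, sum_coord_mul_map_single]
  rw [radialDeriv_radialDeriv hu, add_sub_cancel_right]
  exact sum_coord_mul_map_single ((fderiv ℝ (fderiv ℝ u) x).flip x) x

theorem opL_eq_neg_laplacian_add_eulerShift (s : ℂ) {u : R3 → ℂ} (hu : ContDiff ℝ ∞ u) :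
    opL s u = -Δ u + eulerShift (s + 1) (eulerShift (s + 2) u) := by
  have hu2 : ContDiff ℝ 2 u := hu.of_le (WithTop.coe_le_coe.2 le_top)
  have hE := (contDiff_radialDeriv hu).differentiable (by simp)
  have symbol (x : R3) : ∑ i, ∑ j, ((if i = j then 1 else 0) - (x i : ℂ) * x j) *
      pderiv i (pderiv j u) x = Δ u x - (radialDeriv (radialDeriv u) x - radialDeriv u x) := by
    simp [sub_mul, ← sum_mul_pderiv_pderiv hu2, laplacian_eq_sum_pderiv hu2]
  rw [show eulerShift (s + 2) u = radialDeriv u + (s + 2) • u from rfl,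
    eulerShift_add _ hE ((hu.differentiable (by simp)).const_smul _),
    eulerShift_const_smul _ _ (hu.differentiable (by simp))]
  ext x
  simp only [opL, opL0, opP, symbol, euler_eq_radialDeriv, eulerShift, Pi.add_apply, Pi.neg_apply,
    Pi.smul_apply, smul_eq_mul]
  ring

theorem integral_toSphere_laplacian_eq_fallingEuler {u : R3 → ℂ} (hu : ContDiff ℝ ∞ u) :
    ∫ ξ : sphere (0 : R3) 1, Δ u ξ ∂(volume : Measure R3).toSphere =
      ∫ ξ : sphere (0 : R3) 1, fallingEuler 1 2 u ξ ∂(volume : Measure R3).toSphere := by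
  have hE := (contDiff_radialDeriv hu).differentiable (by simp)
  have expand : fallingEuler 1 2 u = eulerShift 0 (radialDeriv u + u) := by
    have : eulerShift 1 u = radialDeriv u + u := by ext x; simp [eulerShift]
    simp [fallingEuler, this]
  rw [integral_toSphere_laplacian hu, expand, eulerShift_add 0 hE (hu.differentiable (by simp))]
  norm_num [eulerShift]

theorem fallingEuler_opL (k : ℕ) {u : R3 → ℂ} (hu : ContDiff ℝ ∞ u) :
    fallingEuler 1 k (opL (-(k : ℂ) - 1) u) =
      fallingEuler 1 (k + 2) u - Δ (fallingEuler (1 - 2) k u) := by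
  have hE := contDiff_eulerShift (1 - k) hu
  have hΔ : ContDiff ℝ ∞ ((-1 : ℂ) • Δ u) := (contDiff_laplacian hu).const_smul (-1 : ℂ)
  have opL_eq : opL (-(k : ℂ) - 1) u =
      eulerShift (-k) (eulerShift (1 - k) u) + (-1 : ℂ) • Δ u := by
    rw [opL_eq_neg_laplacian_add_eulerShift _ hu, neg_one_smul, add_comm, sub_add_cancel]
    ring_nf
  rw [opL_eq, fallingEuler_add 1 k (contDiff_eulerShift _ hE) hΔ,
    fallingEuler_const_smul 1 (-1) k (contDiff_laplacian hu), fallingEuler_laplacian 1 k hu,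
    fallingEuler_eulerShift _ _ _ hE, fallingEuler_eulerShift _ _ _ hu, neg_one_smul,
    ← sub_eq_add_neg, fallingEuler, fallingEuler, Nat.cast_succ, sub_add_cancel_right]

theorem integral_toSphere_fallingEuler_opL (k : ℕ) {u : R3 → ℂ} (hu : ContDiff ℝ ∞ u) :
    ∫ ξ : sphere (0 : R3) 1, fallingEuler 1 k (opL (-(k : ℂ) - 1) u) ξ
      ∂(volume : Measure R3).toSphere = 0 := by
  have hw := contDiff_fallingEuler (1 - 2) k hu
  have compose : fallingEuler 1 2 (fallingEuler (1 - 2) k u) = fallingEuler 1 (2 + k) u :=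
    mod_cast fallingEuler_fallingEuler 1 2 k hu
  rw [fallingEuler_opL k hu]
  simp only [Pi.sub_apply]
  rw [integral_sub
    (integrable_toSphere_of_continuous _ (contDiff_fallingEuler 1 (k + 2) hu).continuous)
    (integrable_toSphere_of_continuous _ (contDiff_laplacian hw).continuous),
    integral_toSphere_laplacian_eq_fallingEuler hw, add_comm k, ← compose, sub_self]

end EuclideanSpace

section MultiIndexDerivatives

theorem pderiv_comm {u : R3 → ℂ} (hu : ContDiff ℝ 2 u) (i j : Fin 3) :
    pderiv i (pderiv j u) = pderiv j (pderiv i u) := by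
  ext x
  calc pderiv i (pderiv j u) x
      = fderiv ℝ (fderiv ℝ u) x (.single i 1) (.single j 1) := fderiv_fderiv_apply_const hu _ _ x
    _ = fderiv ℝ (fderiv ℝ u) x (.single j 1) (.single i 1) := fderiv_fderiv_comm hu x _ _
    _ = pderiv j (pderiv i u) x := (fderiv_fderiv_apply_const hu _ _ x).symm

theorem contDiff_pderiv_iterate {u : R3 → ℂ} (hu : ContDiff ℝ ∞ u) (i : Fin 3) (n : ℕ) :
    ContDiff ℝ ∞ ((pderiv i)^[n] u) := by
  induction n with
  | zero => exact hu
  | succ n ih => rw [Function.iterate_succ_apply']; exact contDiff_pderiv ih i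

theorem contDiff_multiDeriv {u : R3 → ℂ} (hu : ContDiff ℝ ∞ u) (α : Fin 3 → ℕ) :
    ContDiff ℝ ∞ (multiDeriv α u) :=
  contDiff_pderiv_iterate (contDiff_pderiv_iterate (contDiff_pderiv_iterate hu _ _) _ _) _ _

theorem pderiv_pderiv_iterate {u : R3 → ℂ} (hu : ContDiff ℝ ∞ u) (i j : Fin 3) (n : ℕ) :
    pderiv i ((pderiv j)^[n] u) = (pderiv j)^[n] (pderiv i u) := by
  induction n with
  | zero => rfl
  | succ n ih =>
    rw [Function.iterate_succ_apply', Function.iterate_succ_apply', ← ih,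
      pderiv_comm ((contDiff_pderiv_iterate hu j n).of_le (WithTop.coe_le_coe.2 le_top))]

theorem pderiv_multiDeriv {u : R3 → ℂ} (hu : ContDiff ℝ ∞ u) (i : Fin 3) (α : Fin 3 → ℕ) :
    pderiv i (multiDeriv α u) = multiDeriv (α + Pi.single i 1) u := by
  have h2 := contDiff_pderiv_iterate hu 2 (α 2)
  have h1 := contDiff_pderiv_iterate h2 1 (α 1)
  unfold multiDeriv
  fin_cases i
  · simp [Function.iterate_succ_apply']
  · simp [pderiv_pderiv_iterate h1, Function.iterate_succ_apply']
  · simp [pderiv_pderiv_iterate h1, pderiv_pderiv_iterate h2, Function.iterate_succ_apply']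

theorem pderiv_iterate_eulerShift (c : ℂ) {u : R3 → ℂ} (hu : ContDiff ℝ ∞ u) (i : Fin 3) (n : ℕ) :
    (pderiv i)^[n] (eulerShift c u) = eulerShift (c + n) ((pderiv i)^[n] u) := by
  induction n with
  | zero => simp
  | succ n ih =>
    rw [Function.iterate_succ_apply', Function.iterate_succ_apply', ih, Nat.cast_succ, ← add_assoc]
    exact fderiv_eulerShift_apply _
      ((contDiff_pderiv_iterate hu i n).of_le (WithTop.coe_le_coe.2 le_top)) _

theorem multiDeriv_eulerShift (c : ℂ) {u : R3 → ℂ} (hu : ContDiff ℝ ∞ u) (α : Fin 3 → ℕ) :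
    multiDeriv α (eulerShift c u) = eulerShift (c + ∑ i, (α i : ℂ)) (multiDeriv α u) := by
  have h2 := contDiff_pderiv_iterate hu 2 (α 2)
  have h1 := contDiff_pderiv_iterate h2 1 (α 1)
  simp only [multiDeriv, pderiv_iterate_eulerShift _ hu, pderiv_iterate_eulerShift _ h2,
    pderiv_iterate_eulerShift _ h1, Fin.sum_univ_three]
  ring_nf

end MultiIndexDerivatives

section SobolevBounds

theorem norm_integral_le_sqrt_mul_sqrt {Ω F : Type*} [MeasurableSpace Ω] [NormedAddCommGroup F]
    [NormedSpace ℝ F] {μ : Measure Ω} [IsFiniteMeasure μ] {f : Ω → F} (hf : MemLp f 2 μ) :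
    ‖∫ x, f x ∂μ‖ ≤ √(μ.real univ) * √(∫ x, ‖f x‖ ^ 2 ∂μ) := by
  have hölder := integral_mul_norm_le_Lp_mul_Lq (μ := μ) (f := fun _ => (1 : ℝ))
    (g := fun x => ‖f x‖) Real.HolderConjugate.two_two (memLp_const 1) (by simpa using hf.norm)
  refine (norm_integral_le_integral_norm f).trans ?_
  simpa [Real.sqrt_eq_rpow] using hölder

theorem memLp_two_restrict_ball {E F : Type*} [NormedAddCommGroup E] [ProperSpace E]
    [MeasurableSpace E] [OpensMeasurableSpace E] [NormedAddCommGroup F] {μ : Measure E}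
    [IsFiniteMeasureOnCompacts μ] {f : E → F} (hf : Continuous f) (x : E) (r : ℝ) :
    MemLp f 2 (μ.restrict (ball x r)) :=
  (memLp_two_iff_integrable_sq_norm hf.aestronglyMeasurable).2 <|
    ((hf.norm.pow 2).continuousOn.integrableOn_compact (isCompact_closedBall x r)).mono_set
      ball_subset_closedBall

theorem setIntegral_norm_multiDeriv_sq_le (u : R3 → ℂ) {m : ℕ} {α : Fin 3 → ℕ}
    (hα : ∑ i, α i ≤ m) :
    ∫ x in ball (0 : R3) 1, ‖multiDeriv α u x‖ ^ 2 ≤ sobolevNorm m u ^ 2 := by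
  have integral_nonneg (β : Fin 3 → ℕ) : 0 ≤ ∫ x in ball (0 : R3) 1, ‖multiDeriv β u x‖ ^ 2 :=
    integral_nonneg fun x => sq_nonneg _
  rw [sobolevNorm, Real.sq_sqrt
    (Finset.sum_nonneg fun j _ => Finset.sum_nonneg fun β _ => integral_nonneg β)]
  refine (Finset.single_le_sum (s := Finset.piAntidiag Finset.univ (∑ i, α i))
    (fun β _ => integral_nonneg β) (by simp)).trans ?_
  exact Finset.single_le_sum (f := fun j => ∑ β ∈ Finset.piAntidiag Finset.univ j,
      ∫ x in ball (0 : R3) 1, ‖multiDeriv β u x‖ ^ 2)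
    (fun j _ => Finset.sum_nonneg fun β _ => integral_nonneg β)
    (Finset.mem_range.2 (Nat.lt_succ_of_le hα))

theorem norm_eulerShift_sq_le (c : ℂ) (u : R3 → ℂ) {x : R3} (hx : x ∈ ball (0 : R3) 1) :
    ‖eulerShift c u x‖ ^ 2 ≤ 4 * (∑ i, ‖pderiv i u x‖ ^ 2 + ‖c‖ ^ 2 * ‖u x‖ ^ 2) := by
  have norm_coord (i : Fin 3) : ‖(x i : ℂ)‖ ≤ 1 := by
    rw [Complex.norm_real]
    exact (PiLp.norm_apply_le x i).trans (mem_ball_zero_iff.1 hx).le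
  have triangle : ‖eulerShift c u x‖ ≤ ∑ i, ‖pderiv i u x‖ + ‖c‖ * ‖u x‖ := by
    rw [eulerShift, ← euler_eq_radialDeriv, euler, smul_eq_mul, ← norm_mul]
    refine (norm_add_le _ _).trans (add_le_add_left ((norm_sum_le _ _).trans ?_) _)
    refine Finset.sum_le_sum fun i _ => ?_
    rw [norm_mul]
    exact mul_le_of_le_one_left (norm_nonneg _) (norm_coord i)
  refine (pow_le_pow_left₀ (norm_nonneg _) triangle 2).trans ?_
  rw [← mul_pow]
  simp only [Fin.sum_univ_three]
  set t := ‖c‖ * ‖u x‖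
  nlinarith only [sq_nonneg (‖pderiv 0 u x‖ - ‖pderiv 1 u x‖),
    sq_nonneg (‖pderiv 0 u x‖ - ‖pderiv 2 u x‖), sq_nonneg (‖pderiv 1 u x‖ - ‖pderiv 2 u x‖),
    sq_nonneg (‖pderiv 0 u x‖ - t), sq_nonneg (‖pderiv 1 u x‖ - t),
    sq_nonneg (‖pderiv 2 u x‖ - t)]

theorem setIntegral_norm_eulerShift_sq_le (c : ℂ) {u : R3 → ℂ} (hu : ContDiff ℝ ∞ u) :
    ∫ x in ball (0 : R3) 1, ‖eulerShift c u x‖ ^ 2 ≤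
      4 * (∑ i, (∫ x in ball (0 : R3) 1, ‖pderiv i u x‖ ^ 2) +
        ‖c‖ ^ 2 * ∫ x in ball (0 : R3) 1, ‖u x‖ ^ 2) := by
  have integrable_sq {f : R3 → ℂ} (hf : Continuous f) :
      IntegrableOn (fun x => ‖f x‖ ^ 2) (ball (0 : R3) 1) :=
    (memLp_two_restrict_ball hf 0 1).integrable_norm_pow two_ne_zero
  have integrable_pderiv (i : Fin 3) := integrable_sq (contDiff_pderiv hu i).continuous
  refine (setIntegral_mono_on (integrable_sq (contDiff_eulerShift c hu).continuous) ?_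
    measurableSet_ball fun x hx => norm_eulerShift_sq_le c u hx).trans_eq ?_
  · exact ((integrable_finsetSum _ fun i _ => integrable_pderiv i).add
      ((integrable_sq hu.continuous).const_mul _)).const_mul 4
  · rw [integral_const_mul, integral_add (integrable_finsetSum _ fun i _ => integrable_pderiv i)
      ((integrable_sq hu.continuous).const_mul _), integral_finsetSum _ fun i _ =>
      integrable_pderiv i, integral_const_mul]

theorem setIntegral_norm_multiDeriv_eulerShift_sq_le (c : ℂ) {u : R3 → ℂ} (hu : ContDiff ℝ ∞ u)
    {m : ℕ} {α : Fin 3 → ℕ} (hα : ∑ i, α i ≤ m) :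
    ∫ x in ball (0 : R3) 1, ‖multiDeriv α (eulerShift c u) x‖ ^ 2 ≤
      4 * (3 + ‖c + ∑ i, (α i : ℂ)‖ ^ 2) * sobolevNorm (m + 1) u ^ 2 := by
  have pderiv_le (i : Fin 3) : ∫ x in ball (0 : R3) 1, ‖pderiv i (multiDeriv α u) x‖ ^ 2 ≤
      sobolevNorm (m + 1) u ^ 2 := by
    rw [pderiv_multiDeriv hu]
    refine setIntegral_norm_multiDeriv_sq_le u ?_
    simpa [Finset.sum_add_distrib] using hα
  rw [multiDeriv_eulerShift c hu]
  calc _ ≤ 4 * (∑ i, (∫ x in ball (0 : R3) 1, ‖pderiv i (multiDeriv α u) x‖ ^ 2) +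
        ‖c + ∑ i, (α i : ℂ)‖ ^ 2 * ∫ x in ball (0 : R3) 1, ‖multiDeriv α u x‖ ^ 2) :=
        setIntegral_norm_eulerShift_sq_le _ (contDiff_multiDeriv hu α)
    _ ≤ 4 * (∑ _i : Fin 3, sobolevNorm (m + 1) u ^ 2 +
        ‖c + ∑ i, (α i : ℂ)‖ ^ 2 * sobolevNorm (m + 1) u ^ 2) := by
        gcongr with i
        · exact pderiv_le i
        · exact setIntegral_norm_multiDeriv_sq_le u (hα.trans m.le_succ)
    _ = _ := by simp only [Finset.sum_const, Finset.card_univ, Fintype.card_fin]; ring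

theorem exists_sobolevNorm_eulerShift_le (m : ℕ) (c : ℂ) :
    ∃ C : ℝ, 0 ≤ C ∧ ∀ u : R3 → ℂ, ContDiff ℝ ∞ u →
      sobolevNorm m (eulerShift c u) ≤ C * sobolevNorm (m + 1) u := by
  let S := ∑ j ∈ Finset.range (m + 1), ∑ α ∈ Finset.piAntidiag (Finset.univ : Finset (Fin 3)) j,
    4 * (3 + ‖c + ∑ i, (α i : ℂ)‖ ^ 2)
  have hS : 0 ≤ S := by positivity
  refine ⟨√S, Real.sqrt_nonneg S, fun u hu => ?_⟩
  refine Real.sqrt_le_iff.2 ⟨mul_nonneg (Real.sqrt_nonneg S) (Real.sqrt_nonneg _), ?_⟩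
  rw [mul_pow, Real.sq_sqrt hS, Finset.sum_mul]
  refine Finset.sum_le_sum fun j hj => ?_
  rw [Finset.sum_mul]
  refine Finset.sum_le_sum fun α hα => setIntegral_norm_multiDeriv_eulerShift_sq_le c hu ?_
  rw [(Finset.mem_piAntidiag.1 hα).1]
  exact Nat.lt_succ_iff.1 (Finset.mem_range.1 hj)

theorem exists_sobolevNorm_fallingEuler_le (m k : ℕ) (c : ℂ) :
    ∃ C : ℝ, 0 ≤ C ∧ ∀ u : R3 → ℂ, ContDiff ℝ ∞ u →
      sobolevNorm m (fallingEuler c k u) ≤ C * sobolevNorm (m + k) u := by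
  induction k generalizing m with
  | zero => exact ⟨1, zero_le_one, fun u _ => by simp [fallingEuler]⟩
  | succ k ih =>
    obtain ⟨C, hC, bound⟩ := exists_sobolevNorm_eulerShift_le m (c - k)
    obtain ⟨C', hC', bound'⟩ := ih (m + 1)
    refine ⟨C * C', mul_nonneg hC hC', fun u hu => ?_⟩
    calc sobolevNorm m (fallingEuler c (k + 1) u)
        ≤ C * sobolevNorm (m + 1) (fallingEuler c k u) := bound _ (contDiff_fallingEuler c k hu)
      _ ≤ C * (C' * sobolevNorm (m + 1 + k) u) := by gcongr; exact bound' u hu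
      _ = C * C' * sobolevNorm (m + (k + 1)) u := by rw [mul_assoc, add_assoc, add_comm 1]

theorem exists_norm_integral_toSphere_le_sobolevNorm :
    ∃ C : ℝ, 0 ≤ C ∧ ∀ u : R3 → ℂ, ContDiff ℝ ∞ u →
      ‖∫ ξ : sphere (0 : R3) 1, u ξ ∂(volume : Measure R3).toSphere‖ ≤ C * sobolevNorm 1 u := by
  obtain ⟨C, hC, bound⟩ := exists_sobolevNorm_eulerShift_le 0 3
  let V := √(volume.real (ball (0 : R3) 1))
  refine ⟨V * C, mul_nonneg (Real.sqrt_nonneg _) hC, fun u hu => ?_⟩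
  have hE := (contDiff_eulerShift 3 hu).continuous
  have divergence : ∫ ξ : sphere (0 : R3) 1, u ξ ∂(volume : Measure R3).toSphere =
      ∫ x in ball (0 : R3) 1, eulerShift 3 u x := by
    rw [integral_toSphere_eq_setIntegral_ball _ (hu.of_le (WithTop.coe_le_coe.2 le_top))]
    simp [eulerShift]
  calc _ ≤ V * √(∫ x in ball (0 : R3) 1, ‖eulerShift 3 u x‖ ^ 2) := by
        have : IsFiniteMeasure (volume.restrict (ball (0 : R3) 1)) :=
          isFiniteMeasure_restrict.2 measure_ball_lt_top.ne
        rw [divergence]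
        simpa [V] using norm_integral_le_sqrt_mul_sqrt (memLp_two_restrict_ball hE 0 1)
    _ = V * sobolevNorm 0 (eulerShift 3 u) := by simp [sobolevNorm, multiDeriv]
    _ ≤ V * (C * sobolevNorm 1 u) := by gcongr; exact bound u hu
    _ = V * C * sobolevNorm 1 u := (mul_assoc _ _ _).symm

theorem exists_norm_twistedTheta_le_sobolevNorm (k : ℕ) :
    ∃ C : ℝ, 0 < C ∧ ∀ u : R3 → ℂ, ContDiff ℝ ∞ u →
      ‖twistedTheta k u‖ ≤ C * sobolevNorm (k + 1) u := by
  obtain ⟨C, hC, trace⟩ := exists_norm_integral_toSphere_le_sobolevNorm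
  obtain ⟨C', hC', bound⟩ := exists_sobolevNorm_fallingEuler_le 1 k 1
  refine ⟨‖Y00‖ * (C * C') + 1, by positivity, fun u hu => ?_⟩
  have hv := contDiff_fallingEuler 1 k hu
  calc ‖twistedTheta k u‖
      = ‖Y00‖ * ‖∫ ξ : sphere (0 : R3) 1, fallingEuler 1 k u ξ
          ∂(volume : Measure R3).toSphere‖ := by
        simp [twistedTheta_eq_integral_fallingEuler k hu]
    _ ≤ ‖Y00‖ * (C * (C' * sobolevNorm (1 + k) u)) := by
        gcongr
        exact (trace _ hv).trans (mul_le_mul_of_nonneg_left (bound u hu) hC)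
    _ = ‖Y00‖ * (C * C') * sobolevNorm (k + 1) u := by rw [add_comm 1 k]; ring
    _ ≤ _ := by
        gcongr
        · exact Real.sqrt_nonneg _
        · exact le_add_of_nonneg_right zero_le_one

end SobolevBounds

section Distributions

variable {ε : ℝ}

/-- The partial derivative `∂_i` as a continuous operator on test functions. -/
def pderivCLM (ε : ℝ) (i : Fin 3) : Test ε →L[ℂ] Test ε :=
  TestFunction.lineDerivCLM ℂ (EuclideanSpace.single i (1 : ℝ))

theorem coe_pderivCLM (i : Fin 3) (u : Test ε) : ⇑(pderivCLM ε i u) = pderiv i u := by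
  ext x
  rw [pderivCLM, TestFunction.lineDerivCLM_eq_fderivCLM,
    TestFunction.fderivCLM_apply_of_le _ (by simp)]
  rfl

theorem coe_pderivCLM_pow (i : Fin 3) (n : ℕ) (u : Test ε) :
    ⇑((pderivCLM ε i ^ n) u) = (pderiv i)^[n] u := by
  induction n with
  | zero => rfl
  | succ n ih =>
    rw [pow_succ', mul_apply_eq_comp, coe_pderivCLM, ih, Function.iterate_succ_apply']

/-- The iterated partial derivative `∂^α` as a continuous operator on test functions. -/
def multiDerivCLM (ε : ℝ) (α : Fin 3 → ℕ) : Test ε →L[ℂ] Test ε :=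
  pderivCLM ε 0 ^ α 0 * (pderivCLM ε 1 ^ α 1 * pderivCLM ε 2 ^ α 2)

theorem coe_multiDerivCLM (α : Fin 3 → ℕ) (u : Test ε) :
    ⇑(multiDerivCLM ε α u) = multiDeriv α u := by
  rw [multiDerivCLM, mul_apply_eq_comp, mul_apply_eq_comp,
    coe_pderivCLM_pow, coe_pderivCLM_pow, coe_pderivCLM_pow, multiDeriv]

theorem tendsto_sobolevNorm_zero (ε : ℝ) (m : ℕ) :
    Tendsto (fun u : Test ε => sobolevNorm m u) (𝓝 0) (𝓝 0) := by
  let D (α : Fin 3 → ℕ) := TestFunction.toBoundedContinuousFunctionCLM ℂ ∘L multiDerivCLM ε α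
  let V := volume.real (ball (0 : R3) 1)
  let S (u : Test ε) := √(∑ j ∈ Finset.range (m + 1),
    ∑ α ∈ Finset.piAntidiag (Finset.univ : Finset (Fin 3)) j, ‖D α u‖ ^ 2 * V)
  have setIntegral_le (α : Fin 3 → ℕ) (u : Test ε) :
      ∫ x in ball (0 : R3) 1, ‖multiDeriv α u x‖ ^ 2 ≤ ‖D α u‖ ^ 2 * V := by
    have pointwise (x : R3) : ‖‖multiDeriv α u x‖ ^ 2‖ ≤ ‖D α u‖ ^ 2 := by
      rw [norm_pow, norm_norm, ← coe_multiDerivCLM]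
      gcongr
      exact (D α u).norm_coe_le_norm x
    exact (le_abs_self _).trans
      (norm_setIntegral_le_of_norm_le_const measure_ball_lt_top fun x _ => pointwise x)
  have continuous_bound : Continuous S := by fun_prop
  have bound_zero : S 0 = 0 := by simp [S]
  exact squeeze_zero (fun u => Real.sqrt_nonneg _)
    (fun u => Real.sqrt_le_sqrt <| Finset.sum_le_sum fun j _ => Finset.sum_le_sum fun α _ =>
      setIntegral_le α u) (bound_zero ▸ continuous_bound.tendsto 0)

theorem continuous_of_norm_le_sobolevNorm {m : ℕ} {C : ℝ} (T : Test ε →ₗ[ℂ] ℂ)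
    (bound : ∀ u : Test ε, ‖T u‖ ≤ C * sobolevNorm m u) : Continuous T := by
  refine continuous_of_continuousAt_zero T ?_
  rw [ContinuousAt, map_zero]
  exact squeeze_zero_norm bound (by simpa using (tendsto_sobolevNorm_zero ε m).const_mul C)

theorem twistedTheta_add (k : ℕ) {u v : R3 → ℂ} (hu : ContDiff ℝ ∞ u) (hv : ContDiff ℝ ∞ v) :
    twistedTheta k (u + v) = twistedTheta k u + twistedTheta k v := by
  have huv : ContDiff ℝ ∞ (u + v) := hu.add hv
  simp only [twistedTheta_eq_integral_fallingEuler k, huv, hu, hv, fallingEuler_add 1 k hu hv,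
    Pi.add_apply]
  rw [integral_add
      (integrable_toSphere_of_continuous _ (contDiff_fallingEuler 1 k hu).continuous)
      (integrable_toSphere_of_continuous _ (contDiff_fallingEuler 1 k hv).continuous), mul_add]

theorem twistedTheta_const_smul (k : ℕ) (a : ℂ) {u : R3 → ℂ} (hu : ContDiff ℝ ∞ u) :
    twistedTheta k (a • u) = a * twistedTheta k u := by
  have hau : ContDiff ℝ ∞ (a • u) := hu.const_smul a
  simp only [twistedTheta_eq_integral_fallingEuler k, hau, hu, fallingEuler_const_smul 1 a k hu,
    Pi.smul_apply, smul_eq_mul, integral_const_mul, mul_left_comm]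

/-- The functional `D̃^k Θ_00` on test functions, as a linear map. -/
def twistedThetaLM (ε : ℝ) (k : ℕ) : Test ε →ₗ[ℂ] ℂ where
  toFun u := twistedTheta k u
  map_add' u v := twistedTheta_add k u.contDiff v.contDiff
  map_smul' a u := twistedTheta_const_smul k a u.contDiff

/-- The distribution `D̃^k Θ_00` on `B_{1+ε}`. -/
def twistedThetaDist (ε : ℝ) (k : ℕ) : Dist ε where
  toLinearMap := twistedThetaLM ε k
  cont :=
    have ⟨_, _, bound⟩ := exists_norm_twistedTheta_le_sobolevNorm k
    continuous_of_norm_le_sobolevNorm (twistedThetaLM ε k) fun u => bound u u.contDiff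

theorem isCoMode_twistedThetaDist (ε : ℝ) (k : ℕ) :
    IsCoMode (k + 1) (-(k : ℂ) - 1) (twistedThetaDist ε k) where
  re_gt := by
    simp only [Complex.sub_re, Complex.neg_re, Complex.natCast_re, Complex.one_re]
    push_cast
    linarith
  bounded :=
    have ⟨C, hC, bound⟩ := exists_norm_twistedTheta_le_sobolevNorm k
    ⟨C, hC, fun u => bound u u.contDiff⟩
  annihilates u :=
    calc twistedTheta k (opL (-(k : ℂ) - 1) u) = _ :=
          twistedTheta_eq_integral_fallingEuler k (contDiff_opL _ u.contDiff)
      _ = 0 := by rw [integral_toSphere_fallingEuler_opL k u.contDiff, mul_zero]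

theorem dsupport_twistedThetaDist_subset (ε : ℝ) (k : ℕ) :
    Distribution.dsupport (twistedThetaDist ε k : Test ε → ℂ) ⊆ sphere 0 1 := by
  refine sInter_subset_of_mem ⟨fun u hu => ?_, isClosed_sphere⟩
  have vanishing (ξ : sphere (0 : R3) 1) : fallingEuler 1 k u ξ = 0 := by
    have hξ : u =ᶠ[𝓝 (ξ : R3)] 0 := notMem_tsupport_iff_eventuallyEq.1 fun h => hu h ξ.2
    have radial : radialDeriv u =ᶠ[𝓝 (ξ : R3)] (0 : ℂ) • (u : R3 → ℂ) := by
      filter_upwards [eventuallyEq_radialDeriv hξ] with y hy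
      rw [hy]
      simp [radialDeriv]
    simp [(fallingEuler_eventuallyEq_of_homogeneous 1 0 k
      (u.contDiff.differentiable (by simp)) radial).eq_of_nhds, hξ.eq_of_nhds]
  calc twistedTheta k u = _ := twistedTheta_eq_integral_fallingEuler k u.contDiff
    _ = 0 := by simp [vanishing]

theorem exists_test_eventuallyEq (hε : 0 < ε) {g : R3 → ℂ} (hg : ContDiff ℝ ∞ g) :
    ∃ f : Test ε, ∀ x ∈ closedBall (0 : R3) 1, f =ᶠ[𝓝 x] g := by
  let χ : ContDiffBump (0 : R3) :=
    ⟨1 + ε / 3, 1 + 2 * ε / 3, by positivity, by linarith⟩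
  have smooth : ContDiff ℝ ∞ fun x => χ x • g x := χ.contDiff.smul hg
  have tsupport_subset : tsupport (fun x => χ x • g x) ⊆ closedBall 0 (1 + 2 * ε / 3) :=
    (closure_mono (Function.support_smul_subset_left _ _)).trans_eq χ.tsupport_eq
  refine ⟨⟨_, smooth, ?_, ?_⟩, fun x hx => ?_⟩
  · exact (isCompact_closedBall _ _).of_isClosed_subset (isClosed_tsupport _) tsupport_subset
  · exact tsupport_subset.trans (closedBall_subset_ball (by linarith))
  · have hx' : x ∈ ball (0 : R3) (1 + ε / 3) := closedBall_subset_ball (by linarith) hx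
    filter_upwards [χ.eventuallyEq_one_of_mem_ball hx'] with y hy
    change χ y • g y = g y
    rw [hy, Pi.one_apply, one_smul]

theorem twistedTheta_of_eventuallyEq_norm_pow (k n : ℕ) {u : R3 → ℂ} (hu : ContDiff ℝ ∞ u)
    (h : ∀ ξ : sphere (0 : R3) 1, u =ᶠ[𝓝 (ξ : R3)] fun x => (‖x‖ : ℂ) ^ n) :
    twistedTheta k u = (-1) ^ k * Y00 * ((volume : Measure R3).toSphere.real univ *
      ∏ j ∈ Finset.range k, (1 - (j : ℂ) + n)) := by
  have eigen (ξ : sphere (0 : R3) 1) :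
      fallingEuler 1 k u ξ = ∏ j ∈ Finset.range k, (1 - (j : ℂ) + n) := by
    have radial : radialDeriv u =ᶠ[𝓝 (ξ : R3)] (n : ℂ) • u := by
      filter_upwards [eventuallyEq_radialDeriv (h ξ), h ξ,
        isOpen_compl_singleton.mem_nhds (ne_zero_of_mem_unit_sphere ξ)] with x deriv_eq eq hx
      rw [deriv_eq, radialDeriv_norm_pow n hx, Pi.smul_apply, eq, smul_eq_mul]
    simp [(fallingEuler_eventuallyEq_of_homogeneous 1 n k
      (hu.differentiable (by simp)) radial).eq_of_nhds, (h ξ).eq_of_nhds]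
  simp [twistedTheta_eq_integral_fallingEuler k hu, eigen]

theorem prod_range_one_sub_add_ne_zero {k n : ℕ} (hkn : k ≤ n) :
    ∏ j ∈ Finset.range k, (1 - (j : ℂ) + n) ≠ 0 := by
  refine Finset.prod_ne_zero_iff.2 fun j hj => ?_
  have hj' : j ≤ n := (Finset.mem_range.1 hj).le.trans hkn
  rw [show 1 - (j : ℂ) + n = ((n - j + 1 : ℕ) : ℂ) by push_cast [hj']; ring]
  exact Nat.cast_ne_zero.2 (Nat.succ_ne_zero _)

theorem twistedThetaDist_ne_zero (hε : 0 < ε) (k : ℕ) : twistedThetaDist ε k ≠ 0 := by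
  have smooth : ContDiff ℝ ∞ fun x : R3 => (‖x‖ : ℂ) ^ (2 * k) := by
    simp only [pow_mul, ← Complex.ofReal_pow]
    exact Complex.ofRealCLM.contDiff.comp ((contDiff_norm_sq ℝ).pow k)
  obtain ⟨f, hf⟩ := exists_test_eventuallyEq hε smooth
  have area_ne_zero : (volume : Measure R3).toSphere.real univ ≠ 0 :=
    (measureReal_ne_zero_iff (measure_ne_top _ _)).2
      (Measure.measure_univ_ne_zero.2 (volume : Measure R3).toSphere_ne_zero)
  have value_ne_zero : twistedTheta k f ≠ 0 := by
    rw [twistedTheta_of_eventuallyEq_norm_pow k (2 * k) f.contDiff fun ξ =>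
      hf ξ (sphere_subset_closedBall ξ.2)]
    refine mul_ne_zero (mul_ne_zero (by simp) ?_) (mul_ne_zero (mod_cast area_ne_zero)
      (prod_range_one_sub_add_ne_zero (by lia)))
    rw [Y00, Complex.ofReal_ne_zero]
    positivity
  exact fun h => value_ne_zero (DFunLike.congr_fun h f)

end Distributions

end

end DeSitter

/-- For every `ε > 0` and every `k`, the functional `D̃^k Θ_00` is a distribution on `B_{1+ε}`. It is
a nonzero quasinormal co-mode of Sobolev order `k + 1` at the frequency `s = -k - 1`, and its support
is contained in the unit sphere, the cosmological horizon. -/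
theorem mainTheorem7 (ε : ℝ) (hε : 0 < ε) (k : ℕ) :
    ∃ θ : DeSitter.Dist ε,
      (∀ f : DeSitter.Test ε, θ f = DeSitter.twistedTheta k f) ∧
      DeSitter.IsCoMode (k + 1) (-(k : ℂ) - 1) θ ∧
      θ ≠ 0 ∧
      Distribution.dsupport (θ : DeSitter.Test ε → ℂ) ⊆ Metric.sphere (0 : DeSitter.R3) 1 :=
  ⟨DeSitter.twistedThetaDist ε k, fun _ => rfl, DeSitter.isCoMode_twistedThetaDist ε k,
    DeSitter.twistedThetaDist_ne_zero hε k, DeSitter.dsupport_twistedThetaDist_subset ε k⟩
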